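/- Let $\mathbf T = 0102010010201\cdots$ be the infinite Tribonacci word, i.e. the fixed point starting with $0$ of the morphism $0\mapsto 01$, $1\mapsto 02$, $2\mapsto 0$. Let $T_0=0$, $T_1=T_2=1$ and $T_k=T_{k-1}+T_{k-2}+T_{k-3}$ for $k\ge 3$. For $n\ge 0$ let $(n)_T$ be the canonical Tribonacci representation of $n$, that is, the unique binary word $a_1a_2\cdots a_m$ with no leading zero and no occurrence of $111$ such that $n=\sum_{1\le i\le m}a_iT_{m+2-i}$ (so $(0)_T$ is the empty word). A nonempty word over $\{0<1<2\}$ is a Lyndon word if it is lexicographically less than all of its nonempty proper suffixes. Theorem (Lyndon factors). For every $n\ge 0$, the word $\mathbf T$ has a factor of length $n$ that is a Lyndon word if and only if $(n)_T$, read from left to right, is accepted by the following deterministic automaton. Its states are $0,1,\ldots,65$ together with a non-accepting dead state, the initial state is $0$, and the accepting states are $$1,2,3,4,5,6,7,9,11,14,16,19,21,23,27,29,31,32,34,42,48,50,52,56,61.$$ The transitions are given below, where $q:(r,s)$ means that state $q$ moves to $r$ on input $0$ and to $s$ on input $1$; a dash stands for the dead state, which moves to itself on both inputs: $$\begin{array}{l}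 0:(0,1),\ 1:(2,3),\ 2:(4,5),\ 3:(6,{-}),\ 4:(7,8),\ 5:(9,10),\ 6:(11,12),\ 7:(7,{-}),\ 8:(13,14),\ 9:(15,16),\ 10:(17,{-}),\\ 11:(7,18),\ 12:(19,10),\ 13:(20,21),\ 14:(22,{-}),\ 15:(23,24),\ 16:(25,26),\ 17:(27,12),\ 18:(28,29),\ 19:(30,31),\ 20:({-},8),\ 21:(32,33),\\ 22:(34,35),\ 23:(29,{-}),\ 24:(36,37),\ 25:(38,{-}),\ 26:(28,{-}),\ 27:(29,18),\ 28:(39,40),\ 29:(41,{-}),\ 30:({-},35),\ 31:(29,26),\ 32:(15,42),\\ 33:(43,{-}),\ 34:(29,44),\ 35:(45,46),\ 36:(47,48),\ 37:(49,{-}),\ 38:(48,{-}),\ 39:({-},18),\ 40:(50,33),\ 41:(23,{-}),\ 42:(25,37),\ 43:(51,40),\\ 44:(49,48),\ 45:(30,52),\ 46:(53,{-}),\ 47:({-},24),\ 48:(25,{-}),\ 49:(54,24),\ 50:(47,42),\ 51:(48,18),\ 52:(29,55),\ 53:(56,35),\ 54:({-},44),\\ 55:(57,{-}),\ 56:(25,44),\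 57:(58,59),\ 58:({-},60),\ 59:(61,62),\ 60:(57,25),\ 61:({-},63),\ 62:(64,{-}),\ 63:({-},37),\ 64:(65,59),\ 65:(48,60). \end{array}$$ -/

import Mathlib

/-- Tribonacci numbers: `0, 1, 1, 2, 4, 7, 13, 24, …`. -/
def trib : ℕ → ℕ
  | 0 => 0
  | 1 => 1
  | 2 => 1
  | n + 3 => trib (n + 2) + trib (n + 1) + trib n

/-- The integer `[a₁ a₂ ⋯ aₙ]_T = ∑ aᵢ T_{n+2-i}` represented by a binary word. -/
def tribValue : List (Fin 2) → ℕ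
  | [] => 0
  | a :: w => (a : ℕ) * trib (w.length + 2) + tribValue w

/-- `w` is a canonical Tribonacci representation of `n`: it has value `n`, no leading zero
and no occurrence of the factor `111`. -/
def IsCanonicalRep (n : ℕ) (w : List (Fin 2)) : Prop :=
  tribValue w = n ∧ w.head? ≠ some 0 ∧ ¬ [1, 1, 1] <:+: w

theorem trib_mono_step : ∀ k, trib k ≤ trib (k + 1)
  | 0 => by simp [trib]
  | 1 => by simp [trib]
  | 2 => by simp [trib]
  | k + 3 => by
    have h : trib (k + 3 + 1) = trib (k + 3) + trib (k + 2) + trib (k + 1) := rfl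
    omega

theorem trib_lt_step : ∀ k, trib (k + 2) < trib (k + 3)
  | 0 => by simp [trib]
  | k + 1 => by
    have h1 := trib_lt_step k
    have h2 : trib (k + 1 + 3) = trib (k + 1 + 2) + trib (k + 2) + trib (k + 1) := rfl
    have h5 : 0 < trib (k + 2) := by
      clear h1 h2
      induction k with
      | zero => simp [trib]
      | succ k ih => exact lt_of_lt_of_le ih (trib_mono_step _)
    omega

theorem not_111_cons_zero {w : List (Fin 2)} (h : ¬ [1, 1, 1] <:+: w) :
    ¬ [1, 1, 1] <:+: (0 :: w) := by
  simp [List.infix_cons_iff, h]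

theorem not_111_tail {a : Fin 2} {w : List (Fin 2)} (h : ¬ [1, 1, 1] <:+: (a :: w)) :
    ¬ [1, 1, 1] <:+: w := fun h' => h (List.infix_cons_iff.2 (Or.inr h'))

/-- A word of length `k` without `111` has value less than `T_{k+2}`. -/
theorem tribValue_lt : ∀ w : List (Fin 2), ¬ [1, 1, 1] <:+: w →
    tribValue w < trib (w.length + 2)
  | [], _ => by simp [tribValue, trib]
  | 0 :: w, h => by
    have h1 := tribValue_lt w (not_111_tail h)
    have h2 := trib_mono_step (w.length + 2)
    simp only [tribValue, List.length_cons, Fin.val_zero, zero_mul, zero_add]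
    rw [show w.length + 1 + 2 = w.length + 2 + 1 from rfl]
    omega
  | [1], _ => by simp [tribValue, trib]
  | 1 :: 0 :: w, h => by
    have h1 := tribValue_lt w (not_111_tail (not_111_tail h))
    have h2 : trib (w.length + 1 + 3) =
      trib (w.length + 1 + 2) + trib (w.length + 2) + trib (w.length + 1) := rfl
    simp only [tribValue, List.length_cons, Fin.val_zero, Fin.val_one, zero_mul, zero_add, one_mul]
    rw [show w.length + 1 + 1 + 2 = w.length + 1 + 3 from rfl]
    omega
  | [1, 1], _ => by simp [tribValue, trib]
  | 1 :: 1 :: 0 :: w, h => by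
    have h1 := tribValue_lt w (not_111_tail (not_111_tail (not_111_tail h)))
    have h2 := trib.eq_4 (w.length + 2)
    simp only [tribValue, List.length_cons, Fin.val_zero, Fin.val_one, zero_mul, zero_add, one_mul]
    rw [show w.length + 1 + 1 + 1 + 2 = w.length + 2 + 3 from rfl, h2]
    rw [show w.length + 1 + 1 + 2 = w.length + 2 + 2 from rfl,
      show w.length + 1 + 2 = w.length + 2 + 1 from rfl]
    omega
  | 1 :: 1 :: 1 :: w, h => absurd ⟨[], w, rfl⟩ h

/-- Every `n < T_{k+2}` has a representation of length `k` without `111`. -/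
theorem exists_padded : ∀ k n, n < trib (k + 2) →
    ∃ w : List (Fin 2), w.length = k ∧ tribValue w = n ∧ ¬ [1, 1, 1] <:+: w
  | 0, n, h => ⟨[], rfl, by simp [trib] at h; simp [tribValue, h], by simp⟩
  | 1, n, h => by
    have h' : n < 2 := h
    interval_cases n
    · exact ⟨[0], rfl, rfl, by decide⟩
    · exact ⟨[1], rfl, rfl, by decide⟩
  | 2, n, h => by
    have h' : n < 4 := h
    interval_cases n
    · exact ⟨[0, 0], rfl, rfl, by decide⟩
    · exact ⟨[0, 1], rfl, rfl, by decide⟩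
    · exact ⟨[1, 0], rfl, rfl, by decide⟩
    · exact ⟨[1, 1], rfl, rfl, by decide⟩
  | k + 3, n, h => by
    have e : trib (k + 3 + 2) = trib (k + 4) + trib (k + 3) + trib (k + 2) := trib.eq_4 (k + 2)
    by_cases h1 : n < trib (k + 4)
    · obtain ⟨w, hl, hv, hw⟩ := exists_padded (k + 2) n h1
      exact ⟨0 :: w, by simp [hl], by simp [tribValue, hv], not_111_cons_zero hw⟩
    by_cases h2 : n - trib (k + 4) < trib (k + 3)
    · obtain ⟨w, hl, hv, hw⟩ := exists_padded (k + 1) (n - trib (k + 4)) h2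
      refine ⟨1 :: 0 :: w, by simp [hl], ?_, ?_⟩
      · have e1 : trib (k + 1 + 1 + 2) = trib (k + 4) := rfl
        simp [tribValue, hv, hl]
        omega
      · rw [List.infix_cons_iff]
        rintro (h3 | h3)
        · simp at h3
        · exact not_111_cons_zero hw h3
    · obtain ⟨w, hl, hv, hw⟩ := exists_padded k (n - trib (k + 4) - trib (k + 3)) (by omega)
      refine ⟨1 :: 1 :: 0 :: w, by simp [hl], ?_, ?_⟩
      · have e1 : trib (k + 1 + 1 + 2) = trib (k + 4) := rfl
        have e2 : trib (k + 1 + 2) = trib (k + 3) := rfl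
        simp [tribValue, hv, hl]
        omega
      · rw [List.infix_cons_iff, List.infix_cons_iff]
        rintro (h3 | h3 | h3)
        · simp at h3
        · simp at h3
        · exact not_111_cons_zero hw h3

theorem exists_strip : ∀ w : List (Fin 2), ¬ [1, 1, 1] <:+: w →
    ∃ v, IsCanonicalRep (tribValue w) v
  | [], h => ⟨[], rfl, by simp, h⟩
  | 0 :: w, h => by
    obtain ⟨v, hv⟩ := exists_strip w (not_111_tail h)
    exact ⟨v, by simpa [tribValue] using hv⟩
  | 1 :: w, h => ⟨1 :: w, rfl, by simp, h⟩

theorem tribValue_inj : ∀ v w : List (Fin 2), v.length = w.length →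
    ¬ [1, 1, 1] <:+: v → ¬ [1, 1, 1] <:+: w → tribValue v = tribValue w → v = w
  | [], [], _, _, _, _ => rfl
  | a :: v, b :: w, hl, hv, hw, h => by
    have hl' : v.length = w.length := by simpa using hl
    have h1 := tribValue_lt v (not_111_tail hv)
    have h2 := tribValue_lt w (not_111_tail hw)
    have ih := tribValue_inj v w hl' (not_111_tail hv) (not_111_tail hw)
    simp only [tribValue, hl'] at h h1
    fin_cases a <;> fin_cases b <;> simp at h ⊢
    · exact ih h
    · omega
    · omega
    · exact ih h

theorem trib_le_of_canonical {n : ℕ} {w : List (Fin 2)} (h : IsCanonicalRep n w) (hw : w ≠ []) :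
    trib (w.length + 1) ≤ n := by
  obtain ⟨hv, h0, -⟩ := h
  match w, hw with
  | a :: w, _ =>
    fin_cases a
    · simp at h0
    · simp only [tribValue] at hv
      simp at hv ⊢
      rw [show w.length + 1 + 1 = w.length + 2 from rfl]
      omega

theorem trib_monotone : Monotone trib := monotone_nat_of_le_succ trib_mono_step

/-- Every natural number has exactly one canonical Tribonacci representation. -/
theorem existsUnique_canonicalRep (n : ℕ) : ∃! w, IsCanonicalRep n w := by
  have hex : ∃ w, IsCanonicalRep n w := by
    have hlt : n < trib (n + 2) := by
      induction n with
      | zero => simp [trib]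
      | succ n ih => have := trib_lt_step n; rw [show n + 1 + 2 = n + 3 from rfl]; omega
    obtain ⟨w, -, hv, hw⟩ := exists_padded n n hlt
    obtain ⟨v, h⟩ := exists_strip w hw
    exact ⟨v, hv ▸ h⟩
  have key : ∀ v w, IsCanonicalRep n v → IsCanonicalRep n w → v.length ≤ w.length := by
    intro v w hv hw
    by_contra hlt
    have hne : v ≠ [] := by rintro rfl; simp at hlt
    have h1 := trib_le_of_canonical hv hne
    have h2 := tribValue_lt w hw.2.2
    rw [hw.1] at h2
    have h3 : trib (w.length + 2) ≤ trib (v.length + 1) := trib_monotone (by omega)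
    omega
  obtain ⟨w, hw⟩ := hex
  exact ⟨w, hw, fun v hv => tribValue_inj v w (le_antisymm (key v w hv hw) (key w v hw hv))
    hv.2.2 hw.2.2 (hv.1.trans hw.1.symm)⟩

/-- The canonical Tribonacci representation `(n)_T`, most significant digit first. -/
noncomputable def tribRep (n : ℕ) : List (Fin 2) := (existsUnique_canonicalRep n).exists.choose

/-- The defining property of `(n)_T`. -/
theorem tribRep_spec (n : ℕ) : IsCanonicalRep n (tribRep n) :=
  (existsUnique_canonicalRep n).exists.choose_spec

/-- The morphism `0 → 01`, `1 → 02`, `2 → 0` on letters. -/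
def tribLetter : Fin 3 → List (Fin 3) := ![[0, 1], [0, 2], [0]]

/-- The morphism `0 → 01`, `1 → 02`, `2 → 0` on words. -/
def tribMorphism (w : List (Fin 3)) : List (Fin 3) := w.flatMap tribLetter

theorem tribMorphism_append (u v : List (Fin 3)) :
    tribMorphism (u ++ v) = tribMorphism u ++ tribMorphism v := by
  simp [tribMorphism]

/-- Each iterate `φⁿ(0)` is a proper prefix of the next one. -/
theorem tribMorphism_iterate_succ (n : ℕ) :
    ∃ v, v ≠ [] ∧ tribMorphism^[n + 1] [0] = tribMorphism^[n] [0] ++ v := by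
  induction n with
  | zero => exact ⟨[1], by simp, rfl⟩
  | succ n ih =>
    obtain ⟨v, hv, h⟩ := ih
    refine ⟨tribMorphism v, ?_, ?_⟩
    · match v, hv with
      | a :: v, _ => fin_cases a <;> simp [tribMorphism, tribLetter]
    · rw [Function.iterate_succ_apply' _ (n + 1), h, tribMorphism_append,
        ← Function.iterate_succ_apply' tribMorphism n, h]

theorem lt_length_iterate (n : ℕ) : n < (tribMorphism^[n] [0]).length := by
  induction n with
  | zero => simp
  | succ n ih =>
    obtain ⟨v, hv, h⟩ := tribMorphism_iterate_succ n
    have := List.length_pos_iff.2 hv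
    rw [h, List.length_append]
    omega

/-- The infinite Tribonacci word `0102010010201⋯`, the fixed point of `φ` starting with `0`:
its `n`-th letter is that of `φⁿ(0)`, a word of length greater than `n`. -/
def tribWord (n : ℕ) : Fin 3 := (tribMorphism^[n] [0])[n]'(lt_length_iterate n)

/-- All the words `φᵏ(0)` are prefixes of `tribWord`. -/
theorem tribWord_eq (k i : ℕ) (h : i < (tribMorphism^[k] [0]).length) :
    (tribMorphism^[k] [0])[i] = tribWord i := by
  have step : ∀ a d, ∃ v, tribMorphism^[a + d] [0] = tribMorphism^[a] [0] ++ v := by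
    intro a d
    induction d with
    | zero => exact ⟨[], by simp⟩
    | succ d ih =>
      obtain ⟨v, hv⟩ := ih
      obtain ⟨u, -, hu⟩ := tribMorphism_iterate_succ (a + d)
      exact ⟨v ++ u, by rw [← add_assoc, hu, hv, List.append_assoc]⟩
  have key : ∀ a b (ha : i < (tribMorphism^[a] [0]).length)
      (hb : i < (tribMorphism^[b] [0]).length), a ≤ b →
      (tribMorphism^[a] [0])[i] = (tribMorphism^[b] [0])[i] := by
    intro a b ha hb hab
    obtain ⟨d, rfl⟩ := Nat.exists_eq_add_of_le hab
    obtain ⟨v, hv⟩ := step a d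
    simp only [hv]
    rw [List.getElem_append_left ha]
  rcases le_total k i with hki | hki
  · exact key k i h (lt_length_iterate i) hki
  · exact (key i k (lt_length_iterate i) h hki).symm

/-- The finite word `x` is a factor of the infinite word `a`: `x = a[i] a[i+1] ⋯ a[i+|x|-1]`
for some position `i`. -/
def IsFactorOf {α : Type*} (x : List α) (a : ℕ → α) : Prop :=
  ∃ i, ∀ (j : ℕ) (hj : j < x.length), x[j] = a (i + j)

/-- A Lyndon word: nonempty and lexicographically less than each of its nonempty proper
suffixes. -/
def IsLyndon {α : Type*} [LinearOrder α] (x : List α) : Prop :=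
  x ≠ [] ∧ ∀ y : List α, y <:+ x → y ≠ [] → y ≠ x → x < y

/-- Row `q` (counted from `0`) holds the successor of state `q` under the letter `0`, its successor under the
letter `1`, and whether `q` is accepting. State `66` is the dead state. -/
def lyndonRows : List (Fin 67 × Fin 67 × Bool) :=
  [
    (0, 1, false), (2, 3, true), (4, 5, true), (6, 66, true), (7, 8, true),
    (9, 10, true), (11, 12, true), (7, 66, true), (13, 14, false), (15, 16, true),
    (17, 66, false), (7, 18, true), (19, 10, false), (20, 21, false), (22, 66, true),
    (23, 24, false), (25, 26, true), (27, 12, false), (28, 29, false), (30, 31, true),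
    (66, 8, false), (32, 33, true), (34, 35, false), (29, 66, true), (36, 37, false),
    (38, 66, false), (28, 66, false), (29, 18, true), (39, 40, false), (41, 66, true),
    (66, 35, false), (29, 26, true), (15, 42, true), (43, 66, false), (29, 44, true),
    (45, 46, false), (47, 48, false), (49, 66, false), (48, 66, false), (66, 18, false),
    (50, 33, false), (23, 66, false), (25, 37, true), (51, 40, false), (49, 48, false),
    (30, 52, false), (53, 66, false), (66, 24, false), (25, 66, true), (54, 24, false),
    (47, 42, true), (48, 18, false), (29, 55, true), (56, 35, false), (66, 44, false),
    (57, 66, false), (25, 44, true), (58, 59, false), (66, 60, false), (61, 62, false),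
    (57, 25, false), (66, 63, true), (64, 66, false), (66, 37, false), (65, 59, false),
    (48, 60, false), (66, 66, false)]

theorem length_lyndonRows : lyndonRows.length = 67 := rfl

/-- The row of the state `q`. -/
def lyndonTable (q : Fin 67) : Fin 67 × Fin 67 × Bool :=
  lyndonRows[(q : ℕ)]'(by rw [length_lyndonRows]; exact q.isLt)

/-- The automaton for the lengths of Lyndon factors of the Tribonacci word. -/
def lyndonDFA : DFA (Fin 2) (Fin 67) where
  step q a := if a = 0 then (lyndonTable q).1 else (lyndonTable q).2.1
  start := 0
  accept := {q | (lyndonTable q).2.2 = true}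

/-! Up to a cyclic shift of the letters, φ is the elementary morphism `leftMorph i`, so three
desubstitutions lead from factors of T back to factors of T. Words starting with 0 stay Lyndon, in
both directions, under `leftMorph 0`, under `rightMorph c` for c ≠ 0, and, given a condition on the
last letter, under `leftMorph c` followed by deletion of the leading c. Hence a Lyndon factor
starting with 0 is one of five short words or comes from a shorter such factor by three morphisms
with at most one deletion. On length vectors this reads v ↦ `shiftThree v + d`, with d from a finite
list governed by whether the word ends in 2 (`IsLyndonFactor.lyndonVec`,
`IsLyndonFactor.exists_step`).

Appending three digits t to a representation w acts in the same way: `repVec` goes to `shiftThree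
(repVec w) + repVec t`. So one edge of the graph runs in parallel with three digits read by the
automaton, and only the difference of the two vectors has to be remembered. The tables `dfaCarries`
and `vecCarries` list finitely many such differences and are simulations, one for each direction; a
first component 0 at an accepting state says that length and value agree. -/

/-- The morphism `a ↦ ca` for `a ≠ c`, `c ↦ c`. -/
def leftMorph (c : Fin 3) (w : List (Fin 3)) : List (Fin 3) :=
  w.flatMap fun a => if a = c then [c] else [c, a]

/-- The morphism `a ↦ ac` for `a ≠ c`, `c ↦ c`. -/
def rightMorph (c : Fin 3) (w : List (Fin 3)) : List (Fin 3) :=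
  w.flatMap fun a => if a = c then [c] else [a, c]

/-! ### Elementary morphisms: desubstitution and lexicographic order. -/

section Morphisms

variable {c : Fin 3}

@[simp] theorem leftMorph_nil : leftMorph c [] = [] := rfl

@[simp] theorem rightMorph_nil : rightMorph c [] = [] := rfl

theorem leftMorph_cons (a : Fin 3) (w : List (Fin 3)) :
    leftMorph c (a :: w) = (if a = c then [c] else [c, a]) ++ leftMorph c w := by
  simp [leftMorph]

theorem rightMorph_cons (a : Fin 3) (w : List (Fin 3)) :
    rightMorph c (a :: w) = (if a = c then [c] else [a, c]) ++ rightMorph c w := by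
  simp [rightMorph]

theorem leftMorph_cons_self (w : List (Fin 3)) :
    leftMorph c (c :: w) = c :: leftMorph c w := by
  simp [leftMorph_cons]

theorem leftMorph_cons_ne {a : Fin 3} (h : a ≠ c) (w : List (Fin 3)) :
    leftMorph c (a :: w) = c :: a :: leftMorph c w := by
  simp [leftMorph_cons, h]

theorem rightMorph_cons_self (w : List (Fin 3)) :
    rightMorph c (c :: w) = c :: rightMorph c w := by
  simp [rightMorph_cons]

theorem rightMorph_cons_ne {a : Fin 3} (h : a ≠ c) (w : List (Fin 3)) :
    rightMorph c (a :: w) = a :: c :: rightMorph c w := by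
  simp [rightMorph_cons, h]

theorem leftMorph_append (u v : List (Fin 3)) :
    leftMorph c (u ++ v) = leftMorph c u ++ leftMorph c v := by
  simp [leftMorph]

theorem rightMorph_append (u v : List (Fin 3)) :
    rightMorph c (u ++ v) = rightMorph c u ++ rightMorph c v := by
  simp [rightMorph]

/-- The two morphisms are conjugate by `c`, so facts about one transfer to the other. -/
theorem cons_rightMorph (w : List (Fin 3)) : c :: rightMorph c w = leftMorph c w ++ [c] := by
  induction w with
  | nil => rfl
  | cons a w ih =>
    by_cases h : a = c
    · subst h
      simp [leftMorph_cons_self, rightMorph_cons_self, ih]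
    · simp [leftMorph_cons_ne h, rightMorph_cons_ne h, ih]

theorem leftMorph_head {w : List (Fin 3)} (hw : w ≠ []) : ∃ t, leftMorph c w = c :: t := by
  cases w with
  | nil => exact absurd rfl hw
  | cons a w => by_cases h : a = c <;> simp [leftMorph_cons, h]

theorem leftMorph_getLast? (w : List (Fin 3)) : (leftMorph c w).getLast? = w.getLast? := by
  rcases List.eq_nil_or_concat w with rfl | ⟨w, a, rfl⟩
  · rfl
  · rw [List.concat_eq_append, leftMorph_append]
    by_cases h : a = c <;> simp [leftMorph_cons, h]

theorem rightMorph_getLast? {w : List (Fin 3)} (hw : w ≠ []) :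
    (rightMorph c w).getLast? = some c := by
  rcases List.eq_nil_or_concat w with rfl | ⟨w, a, rfl⟩
  · exact absurd rfl hw
  · rw [List.concat_eq_append, rightMorph_append]
    by_cases h : a = c <;> simp [rightMorph_cons, h]

theorem length_le_length_leftMorph (w : List (Fin 3)) : w.length ≤ (leftMorph c w).length := by
  induction w with
  | nil => simp
  | cons a w ih => by_cases h : a = c <;> simp [leftMorph_cons, h] <;> omega

theorem length_lt_length_leftMorph {a : Fin 3} (ha : a ≠ c) :
    ∀ {w : List (Fin 3)}, a ∈ w → w.length < (leftMorph c w).length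
  | b :: w, h => by
    have h0 := length_le_length_leftMorph (c := c) w
    by_cases hb : b = c
    · obtain rfl := hb.symm
      have := length_lt_length_leftMorph ha ((List.mem_cons.1 h).resolve_left ha)
      simp [leftMorph_cons_self]
      omega
    · simp [leftMorph_cons_ne hb]
      omega

theorem mem_leftMorph {a : Fin 3} {w : List (Fin 3)} (h : a ∈ w) : a ∈ leftMorph c w := by
  simp only [leftMorph, List.mem_flatMap]
  refine ⟨a, h, ?_⟩
  by_cases hc : a = c <;> simp [hc]

theorem suffix_leftMorph {y : List (Fin 3)} :
    ∀ {w : List (Fin 3)}, y <:+ leftMorph c w →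
      ∃ s, s <:+ w ∧ (y = leftMorph c s ∨ ∃ a t, a ≠ c ∧ s = a :: t ∧ y = a :: leftMorph c t)
  | [], h => ⟨[], List.suffix_rfl, Or.inl (by simpa using h)⟩
  | a :: w, h => by
    by_cases ha : a = c
    · obtain rfl := ha.symm
      rw [leftMorph_cons_self, List.suffix_cons_iff] at h
      rcases h with h | h
      · exact ⟨c :: w, List.suffix_rfl, Or.inl (by rw [h, leftMorph_cons_self])⟩
      · obtain ⟨s, hs, hy⟩ := suffix_leftMorph h
        exact ⟨s, hs.trans (List.suffix_cons _ _), hy⟩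
    · rw [leftMorph_cons_ne ha, List.suffix_cons_iff, List.suffix_cons_iff] at h
      rcases h with h | h | h
      · exact ⟨a :: w, List.suffix_rfl, Or.inl (by rw [h, leftMorph_cons_ne ha])⟩
      · exact ⟨a :: w, List.suffix_rfl, Or.inr ⟨a, w, ha, rfl, h⟩⟩
      · obtain ⟨s, hs, hy⟩ := suffix_leftMorph h
        exact ⟨s, hs.trans (List.suffix_cons _ _), hy⟩

theorem suffix_rightMorph {y : List (Fin 3)} :
    ∀ {w : List (Fin 3)}, y <:+ rightMorph c w →
      ∃ s, s <:+ w ∧ (y = rightMorph c s ∨ y = c :: rightMorph c s)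
  | [], h => ⟨[], List.suffix_rfl, Or.inl (by simpa using h)⟩
  | a :: w, h => by
    by_cases ha : a = c
    · obtain rfl := ha.symm
      rw [rightMorph_cons_self, List.suffix_cons_iff] at h
      rcases h with h | h
      · exact ⟨c :: w, List.suffix_rfl, Or.inl (by rw [h, rightMorph_cons_self])⟩
      · obtain ⟨s, hs, hy⟩ := suffix_rightMorph h
        exact ⟨s, hs.trans (List.suffix_cons _ _), hy⟩
    · rw [rightMorph_cons_ne ha, List.suffix_cons_iff, List.suffix_cons_iff] at h
      rcases h with h | h | h
      · exact ⟨a :: w, List.suffix_rfl, Or.inl (by rw [h, rightMorph_cons_ne ha])⟩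
      · exact ⟨w, List.suffix_cons _ _, Or.inr h⟩
      · obtain ⟨s, hs, hy⟩ := suffix_rightMorph h
        exact ⟨s, hs.trans (List.suffix_cons _ _), hy⟩

theorem prefix_leftMorph : ∀ {x w : List (Fin 3)}, x <+: leftMorph c w →
    ∃ y, y <+: w ∧ (x = leftMorph c y ∨ x = leftMorph c y ++ [c])
  | x, [], h => ⟨[], List.prefix_rfl, Or.inl (by simpa using h)⟩
  | x, a :: w, h => by
    by_cases ha : a = c
    · obtain rfl := ha.symm
      rw [leftMorph_cons_self, List.prefix_cons_iff] at h
      rcases h with rfl | ⟨t, rfl, h⟩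
      · exact ⟨[], List.nil_prefix, Or.inl rfl⟩
      · obtain ⟨y, hy, h⟩ := prefix_leftMorph h
        refine ⟨c :: y, List.cons_prefix_cons.2 ⟨rfl, hy⟩, ?_⟩
        rcases h with rfl | rfl <;> simp [leftMorph_cons_self]
    · rw [leftMorph_cons_ne ha, List.prefix_cons_iff] at h
      rcases h with rfl | ⟨t, rfl, h⟩
      · exact ⟨[], List.nil_prefix, Or.inl rfl⟩
      rw [List.prefix_cons_iff] at h
      rcases h with rfl | ⟨t, rfl, h⟩
      · exact ⟨[], List.nil_prefix, Or.inr rfl⟩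
      · obtain ⟨y, hy, h⟩ := prefix_leftMorph h
        refine ⟨a :: y, List.cons_prefix_cons.2 ⟨rfl, hy⟩, ?_⟩
        rcases h with rfl | rfl <;> simp [leftMorph_cons_ne ha]

/-- Desubstitution of the factors of `leftMorph c w`. -/
theorem infix_leftMorph {x w : List (Fin 3)} (h : x <:+: leftMorph c w) :
    ∃ y, y <:+: w ∧ ((x = leftMorph c y ∨ x = leftMorph c y ++ [c]) ∨
      x.head? ≠ some c ∧ (c :: x = leftMorph c y ∨ x = rightMorph c y)) := by
  obtain ⟨t, hxt, ht⟩ := List.infix_iff_prefix_suffix.1 h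
  obtain ⟨s, hs, rfl | ⟨a, t, ha, rfl, rfl⟩⟩ := suffix_leftMorph ht
  · obtain ⟨y, hy, h⟩ := prefix_leftMorph hxt
    exact ⟨y, hy.isInfix.trans hs.isInfix, Or.inl h⟩
  -- Here `x` starts inside a block `ca`; restoring the lost `c` moves its start to a block
  -- boundary.
  · have h1 : c :: x <+: leftMorph c (a :: t) := by
      rw [leftMorph_cons_ne ha]
      exact List.cons_prefix_cons.2 ⟨rfl, hxt⟩
    obtain ⟨y, hy, h⟩ := prefix_leftMorph h1
    refine ⟨y, hy.isInfix.trans hs.isInfix, Or.inr ⟨?_, ?_⟩⟩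
    · rw [List.prefix_cons_iff] at hxt
      rcases hxt with rfl | ⟨t, rfl, -⟩ <;> simp [ha]
    · exact h.imp_right fun h => by
        rw [← cons_rightMorph] at h
        exact (List.cons.inj h).2

/-- Each block starts with the letter it encodes, so the first difference survives. -/
theorem rightMorph_strictMono : StrictMono (rightMorph c) := by
  intro u
  induction u with
  | nil =>
    intro v h
    cases v with
    | nil => exact absurd h (lt_irrefl _)
    | cons b v => by_cases hb : b = c <;> simp [rightMorph_cons, hb]
  | cons a u ih =>
    intro v h
    cases v with
    | nil => simp at h
    | cons b v =>
      rcases List.cons_lt_cons_iff.1 h with h' | ⟨rfl, h'⟩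
      · by_cases ha : a = c <;> by_cases hb : b = c <;>
          simp_all [rightMorph_cons, List.cons_lt_cons_iff]
      · by_cases ha : a = c <;> simp [rightMorph_cons, ha, ih h']

/-- The order can be reversed only when a final `c` in `v` meets a smaller letter `a` in `u`: the
block `c` is then a proper prefix of `ca`. No letter is smaller than `c = 0`. -/
theorem leftMorph_lt : ∀ {u v : List (Fin 3)}, (c = 0 ∨ u.getLast? ≠ some c) →
    (c = 0 ∨ v.getLast? ≠ some c) → u < v → leftMorph c u < leftMorph c v
  | _, [], _, _, h => by simp at h
  | [], b :: v, _, _, _ => by by_cases hb : b = c <;> simp [leftMorph_cons, hb]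
  | a :: u, b :: v, hu, hv, h => by
    rcases List.cons_lt_cons_iff.1 h with h' | ⟨rfl, h'⟩
    · by_cases ha : a = c
      · subst ha
        rw [leftMorph_cons_self, leftMorph_cons_ne h'.ne', List.cons_lt_cons_iff]
        refine Or.inr ⟨rfl, ?_⟩
        cases u with
        | nil => simp
        | cons d u =>
          obtain ⟨t, ht⟩ := leftMorph_head (c := a) (List.cons_ne_nil d u)
          rw [ht, List.cons_lt_cons_iff]
          exact Or.inl h'
      · by_cases hb : b = c
        · subst hb
          rw [leftMorph_cons_self, leftMorph_cons_ne h'.ne, List.cons_lt_cons_iff]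
          refine Or.inr ⟨rfl, ?_⟩
          cases v with
          | nil =>
            rcases hv with rfl | hv
            · exact absurd h' (by simp)
            · simp at hv
          | cons d v =>
            obtain ⟨t, ht⟩ := leftMorph_head (c := b) (List.cons_ne_nil d v)
            rw [ht, List.cons_lt_cons_iff]
            exact Or.inl h'
        · simp [leftMorph_cons_ne ha, leftMorph_cons_ne hb, List.cons_lt_cons_iff, h']
    · have hu' : c = 0 ∨ u.getLast? ≠ some c := by
        cases u with
        | nil => simp
        | cons d u => simpa using hu
      have hv' : c = 0 ∨ v.getLast? ≠ some c := by
        cases v with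
        | nil => simp
        | cons d v => simpa using hv
      have := leftMorph_lt hu' hv' h'
      by_cases ha : a = c <;> simp [leftMorph_cons, ha, this]

theorem leftMorph_lt_iff {u v : List (Fin 3)} (hu : c = 0 ∨ u.getLast? ≠ some c)
    (hv : c = 0 ∨ v.getLast? ≠ some c) : leftMorph c u < leftMorph c v ↔ u < v := by
  refine ⟨fun h => ?_, leftMorph_lt hu hv⟩
  rcases lt_trichotomy u v with h1 | rfl | h1
  · exact h1
  · exact absurd h (lt_irrefl _)
  · exact absurd (leftMorph_lt hv hu h1) h.not_gt

end Morphisms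

/-! ### Lyndon words under the elementary morphisms. -/

section Lyndon

theorem List.IsSuffix.getLast?_eq {α : Type*} {s w : List α} (h : s <:+ w) (hs : s ≠ []) :
    s.getLast? = w.getLast? := by
  obtain ⟨t, rfl⟩ := h
  simp [List.getLast?_append_of_ne_nil _ hs]

theorem IsLyndon.le_of_mem {α : Type*} [LinearOrder α] {a b : α} {x : List α}
    (h : IsLyndon (a :: x)) (hb : b ∈ a :: x) : a ≤ b := by
  obtain ⟨s, t, hst⟩ := List.append_of_mem hb
  by_cases he : b :: t = a :: x
  · exact (List.cons.inj he).1.ge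
  · have := h.2 (b :: t) ⟨s, hst.symm⟩ (by simp) he
    rcases List.cons_lt_cons_iff.1 this with h1 | ⟨h1, -⟩
    · exact h1.le
    · exact h1.le

/-- A Lyndon word of length at least `2` does not end in its first letter. -/
theorem IsLyndon.getLast?_ne {α : Type*} [LinearOrder α] {a : α} {x : List α}
    (h : IsLyndon (a :: x)) (hx : x ≠ []) : (a :: x).getLast? ≠ some a := by
  intro hl
  obtain ⟨y, b, rfl⟩ := (List.eq_nil_or_concat' x).resolve_left hx
  have hb : b = a := by simpa [List.getLast?_cons] using hl
  subst hb
  have := h.2 [b] ⟨b :: y, by simp⟩ (by simp) (by simp)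
  simp at this

/-- A suffix cut inside a block starts with a nonzero letter and is automatically larger; the others
are images of suffixes. -/
theorem isLyndon_leftMorph_zero {w : List (Fin 3)} :
    IsLyndon (leftMorph 0 w) ↔ IsLyndon w := by
  constructor
  · rintro ⟨h0, h⟩
    refine ⟨by rintro rfl; exact h0 rfl, fun s ⟨t, hs⟩ hs0 hsw => ?_⟩
    rw [← leftMorph_lt_iff (c := 0) (Or.inl rfl) (Or.inl rfl)]
    have ht : t ≠ [] := by rintro rfl; exact hsw hs
    refine h _ ⟨leftMorph 0 t, by rw [← hs, leftMorph_append]⟩ ?_ ?_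
    · obtain ⟨r, hr⟩ := leftMorph_head (c := 0) hs0
      simp [hr]
    · obtain ⟨r, hr⟩ := leftMorph_head (c := 0) ht
      rw [← hs, leftMorph_append, hr]
      intro he
      have := congrArg List.length he
      simp at this
      omega
  · rintro ⟨h0, h⟩
    obtain ⟨r, hr⟩ := leftMorph_head (c := 0) h0
    refine ⟨by simp [hr], fun y hy hy0 hyw => ?_⟩
    obtain ⟨s, hs, rfl | ⟨a, t, ha, rfl, rfl⟩⟩ := suffix_leftMorph hy
    · rw [leftMorph_lt_iff (c := 0) (Or.inl rfl) (Or.inl rfl)]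
      exact h s hs (by rintro rfl; exact hy0 rfl) (by rintro rfl; exact hyw rfl)
    · rw [hr, List.cons_lt_cons_iff]
      exact Or.inl (Fin.pos_of_ne_zero ha)

variable {c : Fin 3}

theorem isLyndon_rightMorph (hc : c ≠ 0) {w : List (Fin 3)} :
    IsLyndon (rightMorph c (0 :: w)) ↔ IsLyndon (0 :: w) := by
  constructor
  · rintro ⟨-, h⟩
    refine ⟨by simp, fun s ⟨t, hs⟩ hs0 hsw => ?_⟩
    rw [← (rightMorph_strictMono (c := c)).lt_iff_lt]
    refine h _ ⟨rightMorph c t, by rw [← hs, rightMorph_append]⟩ ?_ ?_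
    · rw [← rightMorph_nil (c := c)]
      exact rightMorph_strictMono.injective.ne hs0
    · exact rightMorph_strictMono.injective.ne hsw
  · rintro ⟨-, h⟩
    refine ⟨by simp [rightMorph_cons_ne hc.symm], fun y hy hy0 hyw => ?_⟩
    obtain ⟨s, hs, rfl | rfl⟩ := suffix_rightMorph hy
    · exact rightMorph_strictMono (h s hs (by rintro rfl; exact hy0 rfl)
        (by rintro rfl; exact hyw rfl))
    · rw [rightMorph_cons_ne hc.symm, List.cons_lt_cons_iff]
      exact Or.inl (Fin.pos_of_ne_zero hc)

/-- Suffixes of `x` starting with `c` exceed `x`, which starts with 0. Any other nonempty suffix,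
with `c` put in front, is the image of a suffix of `0 :: w`. -/
theorem isLyndon_of_cons_eq_leftMorph (hc : c ≠ 0) {x w : List (Fin 3)}
    (hl : (0 :: w).getLast? ≠ some c) (hx : c :: x = leftMorph c (0 :: w)) :
    IsLyndon x ↔ IsLyndon (0 :: w) := by
  have hx' : x = 0 :: leftMorph c w := by
    rw [leftMorph_cons_ne hc.symm] at hx
    exact (List.cons.inj hx).2
  constructor
  · rintro ⟨-, h⟩
    refine ⟨by simp, fun s hs hs0 hsw => ?_⟩
    match s, hs0 with
    | a :: s, _ =>
      by_cases ha : a = 0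
      · subst ha
        rw [← leftMorph_lt_iff (c := c) (Or.inr hl) (Or.inr (by rwa [hs.getLast?_eq (by simp)])),
          ← hx, leftMorph_cons_ne hc.symm, List.cons_lt_cons_iff]
        refine Or.inr ⟨rfl, h _ ?_ (by simp) ?_⟩
        · rcases List.suffix_cons_iff.1 hs with h1 | ⟨t, rfl⟩
          · exact absurd h1 hsw
          · exact ⟨0 :: leftMorph c t ++ [c], by
              simp [hx', leftMorph_append, leftMorph_cons_ne hc.symm]⟩
        · intro he
          rw [hx'] at he
          rcases List.suffix_cons_iff.1 hs with h1 | ⟨t, rfl⟩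
          · exact hsw h1
          · have := congrArg List.length he
            simp [leftMorph_append, leftMorph_cons_ne hc.symm] at this
            omega
      · rw [List.cons_lt_cons_iff]
        exact Or.inl (Fin.pos_of_ne_zero ha)
  · rintro ⟨-, h⟩
    refine ⟨by simp [hx'], fun y hy hy0 hyw => ?_⟩
    have hy' : y <:+ leftMorph c (0 :: w) := by
      rw [← hx]
      exact hy.trans (List.suffix_cons _ _)
    obtain ⟨s, hs, rfl | ⟨a, t, ha, rfl, rfl⟩⟩ := suffix_leftMorph hy'
    · obtain ⟨r, hr⟩ := leftMorph_head (c := c) (w := s) (by rintro rfl; exact hy0 rfl)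
      rw [hr, hx', List.cons_lt_cons_iff]
      exact Or.inl (Fin.pos_of_ne_zero hc)
    · have h1 := h _ hs (by simp) (by
        intro he
        obtain ⟨rfl, rfl⟩ := List.cons.inj he
        exact hyw hx'.symm)
      rw [← leftMorph_lt_iff (c := c) (Or.inr hl) (Or.inr (by rwa [hs.getLast?_eq (by simp)])),
        ← hx, leftMorph_cons_ne ha, List.cons_lt_cons_iff] at h1
      simpa using h1

end Lyndon

/-! ### Factors of the cyclically shifted Tribonacci words. -/

/-- The prefix `φᵏ(0)` of the Tribonacci word, with its letters shifted cyclically by `i`. -/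
def shiftedPrefix (i : Fin 3) (k : ℕ) : List (Fin 3) :=
  (tribMorphism^[k] [0]).map (· + i)

/-- The factors of the Tribonacci word, with their letters shifted cyclically by `i`. -/
def ShiftedFactor (i : Fin 3) (x : List (Fin 3)) : Prop := ∃ k, x <:+: shiftedPrefix i k

/-- φ maps `a` to `0(a+1)`, collapsed to `0` when `a + 1 = 0`: a cyclic shift followed by an
elementary morphism. -/
theorem map_tribMorphism (i : Fin 3) (w : List (Fin 3)) :
    (tribMorphism w).map (· + i) = leftMorph i (w.map (· + (i + 1))) := by
  induction w with
  | nil => rfl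
  | cons a w ih =>
    have h : ∀ i a : Fin 3, (tribLetter a).map (· + i) =
        if a + (i + 1) = i then [i] else [i, a + (i + 1)] := by decide
    rw [List.map_cons, leftMorph_cons, ← ih, ← h]
    simp [tribMorphism]

theorem shiftedPrefix_succ (i : Fin 3) (k : ℕ) :
    shiftedPrefix i (k + 1) = leftMorph i (shiftedPrefix (i + 1) k) := by
  rw [shiftedPrefix, Function.iterate_succ_apply', map_tribMorphism, shiftedPrefix]

theorem shiftedPrefix_prefix_succ (i : Fin 3) (k : ℕ) :
    ∃ b t, shiftedPrefix i (k + 1) = shiftedPrefix i k ++ b :: t := by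
  obtain ⟨v, hv, h⟩ := tribMorphism_iterate_succ k
  match v, hv with
  | b :: t, _ => exact ⟨b + i, t.map (· + i), by simp [shiftedPrefix, h]⟩

theorem isFactorOf_tribWord_iff {x : List (Fin 3)} :
    IsFactorOf x tribWord ↔ ShiftedFactor 0 x := by
  have h0 : ∀ k, shiftedPrefix 0 k = tribMorphism^[k] [0] := fun k => by simp [shiftedPrefix]
  constructor
  · rintro ⟨i, h⟩
    refine ⟨i + x.length, ?_⟩
    rw [h0]
    have hl := lt_length_iterate (i + x.length)
    have hx : x = ((tribMorphism^[i + x.length] [0]).drop i).take x.length := by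
      apply List.ext_getElem
      · simp
        omega
      · intro j h1 h2
        rw [h j h1, List.getElem_take, List.getElem_drop, tribWord_eq]
    refine List.IsInfix.trans ?_ (List.drop_suffix i _).isInfix
    nth_rw 1 [hx]
    exact (List.take_prefix _ _).isInfix
  · rintro ⟨k, s, t, h⟩
    rw [h0] at h
    refine ⟨s.length, fun j hj => ?_⟩
    rw [← tribWord_eq k (s.length + j) (by rw [← h]; simp; omega)]
    simp only [← h]
    rw [List.getElem_append_left (by simp; omega), List.getElem_append_right (by omega)]
    simp

namespace ShiftedFactor

variable {i : Fin 3} {x y : List (Fin 3)}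

theorem of_infix (h : ShiftedFactor i x) (hy : y <:+: x) : ShiftedFactor i y :=
  h.imp fun _ hk => hy.trans hk

theorem exists_append (h : ShiftedFactor i x) : ∃ b, ShiftedFactor i (x ++ [b]) := by
  obtain ⟨k, s, t, h⟩ := h
  obtain ⟨b, r, hk⟩ := shiftedPrefix_prefix_succ i k
  cases t with
  | nil => exact ⟨b, k + 1, s, r, by simp [hk, ← h]⟩
  | cons b t => exact ⟨b, k, s, t, by simp [← h]⟩

theorem image_left (h : ShiftedFactor (i + 1) x) : ShiftedFactor i (leftMorph i x) := by
  obtain ⟨k, s, t, h⟩ := h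
  exact ⟨k + 1, leftMorph i s, leftMorph i t, by
    rw [shiftedPrefix_succ, ← h, leftMorph_append, leftMorph_append]⟩

/-- The image of any letter following `x` supplies the final `i` needed for conjugation. -/
theorem image_right (h : ShiftedFactor (i + 1) x) : ShiftedFactor i (rightMorph i x) := by
  obtain ⟨b, hb⟩ := h.exists_append
  obtain ⟨t, ht⟩ := leftMorph_head (c := i) (List.cons_ne_nil b [])
  refine hb.image_left.of_infix ?_
  rw [leftMorph_append, ht, ← List.singleton_append (l := t), ← List.append_assoc,
    ← cons_rightMorph]
  exact ⟨[i], t, by simp⟩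

theorem exists_infix_leftMorph (h : ShiftedFactor i x) :
    ∃ w, ShiftedFactor (i + 1) w ∧ x <:+: leftMorph i w := by
  obtain ⟨k, h⟩ := h
  obtain ⟨b, t, hk⟩ := shiftedPrefix_prefix_succ i k
  -- Passing from `k` to `k + 1` makes the exponent positive, so that the prefix is an image.
  refine ⟨shiftedPrefix (i + 1) k, ⟨k, List.infix_rfl⟩, ?_⟩
  rw [← shiftedPrefix_succ, hk]
  exact h.trans (List.prefix_append _ _).isInfix

theorem desubst (h : ShiftedFactor i x) : ∃ y, ShiftedFactor (i + 1) y ∧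
    ((x = leftMorph i y ∨ x = leftMorph i y ++ [i]) ∨
      x.head? ≠ some i ∧ (i :: x = leftMorph i y ∨ x = rightMorph i y)) := by
  obtain ⟨w, hw, hx⟩ := h.exists_infix_leftMorph
  obtain ⟨y, hy, h⟩ := infix_leftMorph hx
  exact ⟨y, hw.of_infix hy, h⟩

/-- A factor that starts with `i` and does not end in `i` is the image of a factor. -/
theorem desubst_left (h : ShiftedFactor i x) (hh : x.head? = some i)
    (hl : x.getLast? ≠ some i) : ∃ y, ShiftedFactor (i + 1) y ∧ x = leftMorph i y := by
  obtain ⟨y, hy, (h | h) | h⟩ := h.desubst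
  · exact ⟨y, hy, h⟩
  · rw [h] at hl
    simp at hl
  · exact absurd hh h.1

/-- A factor that does not start with `i` is the image of a factor under `rightMorph i`,
possibly without the last letter. -/
theorem desubst_right (h : ShiftedFactor i x) (hx : x ≠ []) (hh : x.head? ≠ some i) :
    ∃ y, ShiftedFactor (i + 1) y ∧ (x = rightMorph i y ∨
      y.getLast? ≠ some i ∧ i :: x = leftMorph i y) := by
  obtain ⟨y, hy, h | ⟨-, h | h⟩⟩ := h.desubst
  · have hy0 : y ≠ [] ∨ y = [] ∧ x = [i] := by
      by_cases hy0 : y = []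
      · subst hy0
        rcases h with rfl | rfl
        · exact absurd rfl hx
        · exact Or.inr ⟨rfl, rfl⟩
      · exact Or.inl hy0
    rcases hy0 with hy0 | ⟨-, rfl⟩
    · obtain ⟨t, ht⟩ := leftMorph_head (c := i) hy0
      rw [ht] at h
      rcases h with rfl | rfl <;> simp at hh
    · simp at hh
  -- If `y` ends in `i`, conjugation turns this case into an exact image under `rightMorph i`.
  · by_cases hl : y.getLast? = some i
    · obtain ⟨z, rfl⟩ := List.getLast?_eq_some_iff.1 hl
      refine ⟨z, hy.of_infix (List.prefix_append _ _).isInfix, Or.inl ?_⟩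
      rw [leftMorph_append, leftMorph_cons_self, leftMorph_nil, ← cons_rightMorph] at h
      exact (List.cons.inj h).2
    · exact ⟨y, hy, Or.inr ⟨hl, h⟩⟩
  · exact ⟨y, hy, Or.inl h⟩

theorem of_cons_eq_leftMorph (h : ShiftedFactor (i + 1) y) (hx : i :: x = leftMorph i y) :
    ShiftedFactor i x :=
  h.image_left.of_infix (hx ▸ (List.suffix_cons _ _).isInfix)

/-- The Tribonacci word has no two adjacent nonzero letters. -/
theorem eq_zero_or_eq_zero {a b : Fin 3} (h : ShiftedFactor 0 [a, b]) : a = 0 ∨ b = 0 := by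
  by_contra! hab
  obtain ⟨y, -, h | ⟨-, h⟩⟩ := h.desubst_right (by simp) (by simpa using hab.1)
  · cases y with
    | nil => simp at h
    | cons d y =>
      by_cases hd : d = 0
      · subst hd
        rw [rightMorph_cons_self] at h
        exact hab.1 (List.cons.inj h).1
      · rw [rightMorph_cons_ne hd] at h
        simp [hab.2] at h
  · match y with
    | [] => simp at h
    | [d] => by_cases hd : d = 0 <;> simp [leftMorph_cons, hd] at h
    | d :: e :: y =>
      obtain ⟨t, ht⟩ := leftMorph_head (c := 0) (List.cons_ne_nil e y)
      rw [leftMorph_cons, ht] at h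
      by_cases hd : d = 0 <;> simp [hd, hab] at h

theorem length_le_one_of_zero_notMem (h : ShiftedFactor 0 x) (h0 : 0 ∉ x) : x.length ≤ 1 := by
  match x with
  | [] => simp
  | [a] => simp
  | a :: b :: t =>
    have := (h.of_infix (y := [a, b]) ⟨[], t, rfl⟩).eq_zero_or_eq_zero
    simp at h0
    grind

end ShiftedFactor

/-! ### Base cases of the descent. -/

/-- The Lyndon factors over `{1, 2}` in the first shift of the Tribonacci word. -/
theorem ShiftedFactor.mem_of_isLyndon {a : Fin 3} {y : List (Fin 3)}
    (h : ShiftedFactor 1 (a :: y)) (hL : IsLyndon (a :: y)) (ha : a ≠ 0) :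
    a :: y ∈ ([[1], [2], [1, 2], [1, 1, 2]] : List (List (Fin 3))) := by
  by_cases hy : y = []
  · subst hy
    have : ∀ a : Fin 3, a ≠ 0 →
        [a] ∈ ([[1], [2], [1, 2], [1, 1, 2]] : List (List (Fin 3))) := by decide
    exact this a ha
  have hlast := hL.getLast?_ne hy
  have hle : ∀ b ∈ a :: y, a ≤ b := fun b hb => hL.le_of_mem hb
  -- The last letter exceeds the first, so the word starts with 1 and ends in 2.
  have ha1 : a = 1 := by
    obtain ⟨b, hb⟩ : ∃ b, (a :: y).getLast? = some b := ⟨_, List.getLast?_cons⟩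
    have h1 := hle b (List.mem_of_getLast? hb)
    have h2 : b ≠ a := by
      rintro rfl
      exact hlast hb
    clear * - ha h1 h2
    revert a b
    decide
  subst ha1
  obtain ⟨z, (hz : ShiftedFactor 2 z), hyz⟩ := h.desubst_left rfl hlast
  have hz0 : 0 ∉ z := fun h0 => by
    have := hle 0 (hyz ▸ mem_leftMorph h0)
    simp at this
  have hzl : z.getLast? = some 2 := by
    rw [← leftMorph_getLast? (c := 1), ← hyz]
    obtain ⟨b, hb⟩ : ∃ b, (1 :: y).getLast? = some b := ⟨_, List.getLast?_cons⟩
    have h1 := hle b (List.mem_of_getLast? hb)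
    rw [hb] at hlast ⊢
    clear * - h1 hlast
    revert b
    decide
  obtain ⟨v, (hv : ShiftedFactor 0 v), hzv⟩ := hz.desubst
  have hv0 : 0 ∉ v := by
    intro h0
    have h1 := mem_leftMorph (c := 2) h0
    have h2 : 0 ∈ 2 :: rightMorph 2 v := by
      rw [cons_rightMorph]
      exact List.mem_append_left _ h1
    rcases hzv with (rfl | rfl) | ⟨-, h | rfl⟩
    · exact hz0 h1
    · exact hz0 (List.mem_append_left _ h1)
    · rw [← h] at h1
      simp [hz0] at h1
    · simp [hz0] at h2
  have hv1 := hv.length_le_one_of_zero_notMem hv0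
  have hv' : v = [] ∨ v = [1] ∨ v = [2] := by
    match v with
    | [] => simp
    | [b] =>
      have : ∀ b : Fin 3, 0 ≠ b → b = 1 ∨ b = 2 := by decide
      simpa using this b (by simpa using hv0)
    | _ :: _ :: _ => simp at hv1
  -- The images under `leftMorph 1` are 12, 112, 12112 and 1212; the last two have the smaller
  -- suffixes 112 and 12.
  have hcases : z = [2] ∨ z = [1, 2] ∨ z = [2, 1, 2] ∨ z = [2, 2] := by
    rcases hv' with rfl | rfl | rfl <;> rcases hzv with (rfl | rfl) | ⟨-, h | rfl⟩ <;>
      simp_all [leftMorph, rightMorph]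
  rcases hcases with rfl | rfl | rfl | rfl
  · simp [hyz, leftMorph]
  · simp [hyz, leftMorph]
  · rw [hyz] at hL
    exact absurd (hL.2 [1, 1, 2] ⟨[1, 2], rfl⟩ (by simp) (by decide)) (by decide)
  · rw [hyz] at hL
    exact absurd (hL.2 [1, 2] ⟨[1, 2], rfl⟩ (by simp) (by decide)) (by decide)

/-! ### Length vectors and the graph of Lyndon factors. -/

/-- The companion map `(a, b, c) ↦ (b, c, a + b + c)` of the Tribonacci recurrence, iterated
three times. -/
def shiftThree (v : ℤ × ℤ × ℤ) : ℤ × ℤ × ℤ :=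
  (v.1 + v.2.1 + v.2.2, v.1 + 2 * v.2.1 + 2 * v.2.2, 2 * v.1 + 3 * v.2.1 + 4 * v.2.2)

theorem shiftThree_add (u v : ℤ × ℤ × ℤ) :
    shiftThree (u + v) = shiftThree u + shiftThree v := by
  simp only [shiftThree, Prod.fst_add, Prod.snd_add, Prod.mk_add_mk, Prod.mk.injEq]
  refine ⟨?_, ?_, ?_⟩ <;> ring

/-- The lengths of `w`, `leftMorph 2 w` and `leftMorph 1 (leftMorph 2 w)`. -/
def lengthVec : List (Fin 3) → ℤ × ℤ × ℤ
  | [] => 0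
  | a :: w => ![(1, 2, 4), (1, 2, 3), (1, 1, 2)] a + lengthVec w

theorem lengthVec_append (u v : List (Fin 3)) :
    lengthVec (u ++ v) = lengthVec u + lengthVec v := by
  induction u with
  | nil => simp [lengthVec]
  | cons a u ih => simp [lengthVec, ih, add_assoc]

theorem lengthVec_fst (w : List (Fin 3)) : (lengthVec w).1 = w.length := by
  induction w with
  | nil => rfl
  | cons a w ih =>
    have : ∀ a : Fin 3, ((![(1, 2, 4), (1, 2, 3), (1, 1, 2)] : Fin 3 → ℤ × ℤ × ℤ) a).1 = 1 := by
      decide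
    rw [lengthVec, Prod.fst_add, this, ih]
    push_cast [List.length_cons]
    ring

/-- Only letter counts matter, so `rightMorph` may be replaced by `leftMorph` in length
computations. -/
theorem lengthVec_perm {u v : List (Fin 3)} (h : u.Perm v) : lengthVec u = lengthVec v := by
  induction h with
  | nil => rfl
  | cons a _ ih => simp only [lengthVec, ih]
  | swap a b l =>
    simp only [lengthVec]
    abel
  | trans _ _ h1 h2 => exact h1.trans h2

theorem rightMorph_perm (c : Fin 3) (w : List (Fin 3)) :
    (rightMorph c w).Perm (leftMorph c w) := by
  have h : (c :: rightMorph c w).Perm (c :: leftMorph c w) := by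
    rw [cons_rightMorph]
    exact List.perm_append_comm
  exact h.cons_inv

theorem leftMorph_perm {c : Fin 3} {u v : List (Fin 3)} (h : u.Perm v) :
    (leftMorph c u).Perm (leftMorph c v) := h.flatMap_right _

theorem lengthVec_leftMorph (w : List (Fin 3)) :
    lengthVec (leftMorph 0 (leftMorph 1 (leftMorph 2 w))) = shiftThree (lengthVec w) := by
  induction w with
  | nil => rfl
  | cons a w ih =>
    have h : ∀ a : Fin 3, lengthVec (leftMorph 0 (leftMorph 1 (leftMorph 2 [a]))) =
      shiftThree (lengthVec [a]) := by decide
    rw [← List.singleton_append, leftMorph_append, leftMorph_append, leftMorph_append,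
      lengthVec_append, lengthVec_append, shiftThree_add, ih, h]

/-- The class of a word: does it end in the letter `2`? -/
def lastClass (x : List (Fin 3)) : Fin 3 := if x.getLast? = some 2 then 1 else 0

/-- The edges `(c, c', d)` of the graph that generates the length vectors of the Lyndon factors:
from a vector `v` in class `c` to the vector `shiftThree v + d` in class `c'`. Class `2` is the
source. -/
def lyndonEdges : List (Fin 3 × Fin 3 × ℤ × ℤ × ℤ) :=
  [(2, 2, 0, 0, 0), (2, 0, 1, 2, 4), (2, 0, 2, 4, 7), (2, 1, 2, 3, 6), (2, 1, 4, 7, 13),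
    (2, 1, 6, 11, 20), (0, 0, 0, 0, 0), (0, 1, -2, -4, -7), (0, 0, -4, -7, -13),
    (1, 0, 0, 0, 0), (1, 1, -2, -4, -7)]

/-- The vectors generated by `lyndonEdges`. -/
inductive LyndonVec : Fin 3 → ℤ × ℤ × ℤ → Prop
  | source : LyndonVec 2 0
  | step {c c' : Fin 3} {v d : ℤ × ℤ × ℤ} (h : LyndonVec c v) (hd : (c, c', d) ∈ lyndonEdges) :
    LyndonVec c' (shiftThree v + d)

/-- A Lyndon factor of the Tribonacci word that starts with `0`. -/
structure IsLyndonFactor (x : List (Fin 3)) : Prop where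
  factor : ShiftedFactor 0 x
  lyndon : IsLyndon x
  head : x.head? = some 0

theorem isLyndon_iff_tails {x : List (Fin 3)} :
    IsLyndon x ↔ x ≠ [] ∧ ∀ y ∈ x.tails, y ≠ [] → y ≠ x → x < y := by
  simp [IsLyndon, List.mem_tails]

/-- The edges leaving the source carry the vectors of 0, 01, 02, 0102 and 010102; the loop at the
source matches leading zero digits. -/
theorem LyndonVec.of_source {c : Fin 3} {d : ℤ × ℤ × ℤ} (hd : (2, c, d) ∈ lyndonEdges) :
    LyndonVec c d := by
  have := LyndonVec.source.step hd
  rwa [show shiftThree 0 = 0 from rfl, zero_add] at this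

theorem lastClass_leftMorph (c : Fin 3) (x : List (Fin 3)) :
    lastClass (leftMorph c x) = lastClass x := by
  rw [lastClass, leftMorph_getLast?, lastClass]

theorem getLast?_of_cons_eq {c : Fin 3} {x w : List (Fin 3)} (hx : x ≠ [])
    (h : c :: x = leftMorph c w) : x.getLast? = w.getLast? := by
  rw [← leftMorph_getLast? (c := c) w, ← h]
  cases x with
  | nil => exact absurd rfl hx
  | cons a x => simp

theorem length_le_length_rightMorph (c : Fin 3) (w : List (Fin 3)) :
    w.length ≤ (rightMorph c w).length := by
  rw [(rightMorph_perm c w).length_eq]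
  exact length_le_length_leftMorph w

/-- One step of the descent, used for `i = 1` and `i = 2`. A preimage starting with another letter
would contradict the initial 0. -/
theorem IsLyndon.desubst_right {i : Fin 3} (hi : i ≠ 0) {x : List (Fin 3)}
    (hL : IsLyndon (0 :: x)) (h : ShiftedFactor i (0 :: x)) :
    ∃ y, ShiftedFactor (i + 1) (0 :: y) ∧ IsLyndon (0 :: y) ∧ y.length ≤ x.length ∧
      (0 :: x = rightMorph i (0 :: y) ∨
        (0 :: y).getLast? ≠ some i ∧ i :: 0 :: x = leftMorph i (0 :: y)) := by
  obtain ⟨z, hzF, hz⟩ := h.desubst_right (by simp) (by simpa using hi.symm)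
  obtain ⟨z, rfl⟩ : ∃ z', z = 0 :: z' := by
    cases z with
    | nil => simp at hz
    | cons b z =>
      by_cases hb : b = i
      · subst hb
        rcases hz with hz | ⟨-, hz⟩
        · rw [rightMorph_cons_self] at hz
          exact absurd (List.cons.inj hz).1.symm hi
        · cases z with
          | nil => simp [leftMorph] at hz
          | cons d z =>
            obtain ⟨r, hr⟩ := leftMorph_head (c := b) (List.cons_ne_nil d z)
            rw [leftMorph_cons_self, hr] at hz
            exact absurd (List.cons.inj (List.cons.inj hz).2).1.symm hi
      · rcases hz with hz | ⟨-, hz⟩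
        · rw [rightMorph_cons_ne hb] at hz
          exact ⟨z, by rw [← (List.cons.inj hz).1]⟩
        · rw [leftMorph_cons_ne hb] at hz
          exact ⟨z, by rw [← (List.cons.inj (List.cons.inj hz).2).1]⟩
  refine ⟨z, hzF, ?_, ?_, hz⟩
  · rcases hz with hz | ⟨hl, hz⟩
    · rwa [hz, isLyndon_rightMorph hi] at hL
    · rwa [isLyndon_of_cons_eq_leftMorph hi hl hz] at hL
  · rcases hz with hz | ⟨-, hz⟩
    · have := length_le_length_rightMorph i (0 :: z)
      rw [← hz] at this
      simpa using this
    · have := length_lt_length_leftMorph hi.symm (List.mem_cons_self (a := 0) (l := z))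
      rw [← hz] at this
      simpa using this

theorem lastClass_rightMorph_one (w : List (Fin 3)) : lastClass (rightMorph 1 w) = 0 := by
  by_cases hw : w = []
  · subst hw
    rfl
  · simp [lastClass, rightMorph_getLast? hw]

theorem lengthVec_rightMorph_rightMorph (w : List (Fin 3)) :
    lengthVec (leftMorph 0 (rightMorph 1 (rightMorph 2 w))) = shiftThree (lengthVec w) := by
  rw [← lengthVec_leftMorph]
  exact lengthVec_perm (leftMorph_perm ((rightMorph_perm _ _).trans
    (leftMorph_perm (rightMorph_perm _ _))))

/-- The correction removes the deleted letter 1, which `leftMorph 0` would turn into 01. -/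
theorem lengthVec_of_cons_eq_rightMorph {w y : List (Fin 3)}
    (h : 1 :: y = leftMorph 1 (rightMorph 2 w)) :
    lengthVec (leftMorph 0 y) = shiftThree (lengthVec w) + (-2, -4, -7) := by
  have h1 : lengthVec (leftMorph 0 (1 :: y)) = shiftThree (lengthVec w) := by
    rw [← lengthVec_leftMorph, h]
    exact lengthVec_perm (leftMorph_perm (leftMorph_perm (rightMorph_perm _ _)))
  rw [← h1, ← List.singleton_append, leftMorph_append, lengthVec_append,
    show lengthVec (leftMorph 0 [1]) = (2, 4, 7) from rfl]
  ext <;> simp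

/-- The letter 2 is deleted one level earlier, so the correction is the vector of its image 0201. -/
theorem lengthVec_rightMorph_of_cons_eq {w z : List (Fin 3)} (h : 2 :: z = leftMorph 2 w) :
    lengthVec (leftMorph 0 (rightMorph 1 z)) = shiftThree (lengthVec w) + (-4, -7, -13) := by
  have h1 : lengthVec (leftMorph 0 (rightMorph 1 (2 :: z))) = shiftThree (lengthVec w) := by
    rw [← lengthVec_leftMorph, h]
    exact lengthVec_perm (leftMorph_perm (rightMorph_perm _ _))
  rw [← h1, ← List.singleton_append, rightMorph_append, leftMorph_append, lengthVec_append,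
    show lengthVec (leftMorph 0 (rightMorph 1 [2])) = (4, 7, 13) from rfl]
  ext <;> simp

theorem IsLyndonFactor.lyndonVec {x : List (Fin 3)} (h : IsLyndonFactor x) :
    LyndonVec (lastClass x) (lengthVec x) := by
  induction hn : x.length using Nat.strong_induction_on generalizing x with
  | _ n ih =>
  subst hn
  obtain ⟨hF, hL, hh⟩ := h
  obtain ⟨t, rfl⟩ := List.head?_eq_some_iff.1 hh
  by_cases ht : t = []
  · subst ht
    exact LyndonVec.of_source (by decide)
  obtain ⟨y, (hyF : ShiftedFactor 1 y), hy⟩ := hF.desubst_left rfl (hL.getLast?_ne ht)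
  rw [hy] at hL ih ⊢
  have hyL := isLyndon_leftMorph_zero.1 hL
  obtain ⟨a, y, rfl⟩ := List.exists_cons_of_ne_nil hyL.1
  by_cases ha : a ≠ 0
  · have := hyF.mem_of_isLyndon hyL ha
    simp only [List.mem_cons, List.not_mem_nil, or_false] at this
    rcases this with h | h | h | h <;> rw [h] <;> exact LyndonVec.of_source (by decide)
  obtain rfl : a = 0 := not_not.1 ha
  have hy0 : y ≠ [] := by
    rintro rfl
    exact ht (List.cons.inj hy).2
  -- The last letter is nonzero, so `leftMorph 0` strictly lengthens the word; this makes the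
  -- induction decrease.
  have hlen : (0 :: y).length < (leftMorph 0 (0 :: y)).length := by
    obtain ⟨z, b, rfl⟩ := (List.eq_nil_or_concat' y).resolve_left hy0
    refine length_lt_length_leftMorph (a := b) ?_ (by simp)
    rintro rfl
    exact hyL.getLast?_ne hy0 (by simp [List.getLast?_cons])
  rw [lastClass_leftMorph]
  obtain ⟨z, (hzF : ShiftedFactor 2 (0 :: z)), hzL, hzlen, hz⟩ :=
    hyL.desubst_right (by decide) hyF
  obtain ⟨w, (hwF : ShiftedFactor 0 (0 :: w)), hwL, hwlen, hw⟩ :=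
    hzL.desubst_right (by decide) hzF
  have hW := ih (0 :: w).length (by simp at hlen ⊢; omega) ⟨hwF, hwL, rfl⟩ rfl
  rcases hz with hz | ⟨hzl, hz⟩ <;> rcases hw with hw | ⟨hwl, hw⟩
  · rw [hz, lastClass_rightMorph_one, hw, lengthVec_rightMorph_rightMorph,
      ← add_zero (shiftThree _)]
    refine hW.step ?_
    rw [lastClass]
    split_ifs <;> decide
  · rw [hz, lastClass_rightMorph_one, lengthVec_rightMorph_of_cons_eq hw]
    refine hW.step ?_
    rw [lastClass, if_neg hwl]
    decide
  · have h2 : lastClass (0 :: y) = 1 := by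
      rw [lastClass, getLast?_of_cons_eq (by simp) hz, hw, rightMorph_getLast? (by simp)]
      rfl
    rw [h2, lengthVec_of_cons_eq_rightMorph (by rw [hz, hw])]
    refine hW.step ?_
    rw [lastClass]
    split_ifs <;> decide
  -- Two deletions cannot both occur: `0 :: w` would end in neither 1 nor 2, hence be the single
  -- letter 0, and `y` would be empty.
  · rw [getLast?_of_cons_eq (by simp) hw] at hzl
    have hw0 : w = [] := by
      by_contra hw0
      obtain ⟨b, hb⟩ : ∃ b, (0 :: w).getLast? = some b := ⟨_, List.getLast?_cons⟩
      have h0 := hwL.getLast?_ne hw0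
      rw [hb] at hwl hzl h0
      clear * - hwl hzl h0
      revert b
      decide
    subst hw0
    obtain rfl : z = [] := by simpa [leftMorph] using hw
    exact absurd (by simpa [leftMorph] using hz) hy0

theorem isLyndonFactor_leftMorph {y : List (Fin 3)} (hF : ShiftedFactor 1 y) (hL : IsLyndon y) :
    IsLyndonFactor (leftMorph 0 y) := by
  obtain ⟨t, ht⟩ := leftMorph_head (c := 0) hL.1
  exact ⟨hF.image_left, isLyndon_leftMorph_zero.2 hL, by rw [ht]; rfl⟩

/-- `φ⁵(0)` is the first iterate that contains 010102, the longest base word. -/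
theorem isLyndonFactor_of_shiftedPrefix {x : List (Fin 3)} (hF : x <:+: shiftedPrefix 0 5)
    (hL : x ≠ [] ∧ ∀ y ∈ x.tails, y ≠ [] → y ≠ x → x < y) (hh : x.head? = some 0) :
    IsLyndonFactor x := ⟨⟨5, hF⟩, isLyndon_iff_tails.2 hL, hh⟩

/-- The descent is reversible: an edge prescribes which letter, if any, to delete. Deleting the 2
requires a word not ending in 2, hence class 0. -/
theorem IsLyndonFactor.exists_step {w : List (Fin 3)} (h : IsLyndonFactor w) {c' : Fin 3}
    {d : ℤ × ℤ × ℤ} (hd : (lastClass w, c', d) ∈ lyndonEdges) :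
    ∃ x, IsLyndonFactor x ∧ lastClass x = c' ∧
      lengthVec x = shiftThree (lengthVec w) + d := by
  obtain ⟨hF, hL, hh⟩ := h
  obtain ⟨w, rfl⟩ := List.head?_eq_some_iff.1 hh
  have h2F : ShiftedFactor 2 (rightMorph 2 (0 :: w)) := hF.image_right
  have h2L : IsLyndon (rightMorph 2 (0 :: w)) := (isLyndon_rightMorph (by decide)).2 hL
  have h2e : rightMorph 2 (0 :: w) = 0 :: 2 :: rightMorph 2 w := rightMorph_cons_ne (by decide) _
  have hc : lastClass (0 :: w) ≠ 2 := by
    rw [lastClass]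
    split_ifs <;> decide
  have hedges : ∀ e ∈ lyndonEdges, e.1 ≠ 2 → e.2.1 = 0 ∧ e.2.2 = 0 ∨
      e.2.1 = 1 ∧ e.2.2 = (-2, -4, -7) ∨ e.1 = 0 ∧ e.2.1 = 0 ∧ e.2.2 = (-4, -7, -13) := by
    decide
  rcases hedges _ hd hc with ⟨rfl, rfl⟩ | ⟨rfl, rfl⟩ | ⟨hc0, rfl, rfl⟩
  · refine ⟨leftMorph 0 (rightMorph 1 (rightMorph 2 (0 :: w))), isLyndonFactor_leftMorph ?_ ?_,
      ?_, ?_⟩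
    · exact h2F.image_right
    · rw [h2e] at h2L ⊢
      exact (isLyndon_rightMorph (by decide)).2 h2L
    · rw [lastClass_leftMorph, lastClass_rightMorph_one]
    · rw [lengthVec_rightMorph_rightMorph, add_zero]
  · have hl : (rightMorph 2 (0 :: w)).getLast? ≠ some 1 := by
      rw [rightMorph_getLast? (by simp)]
      decide
    have hy : 1 :: 0 :: leftMorph 1 (2 :: rightMorph 2 w) =
        leftMorph 1 (rightMorph 2 (0 :: w)) := by
      rw [h2e, leftMorph_cons_ne (a := 0) (by decide)]
    refine ⟨leftMorph 0 (0 :: leftMorph 1 (2 :: rightMorph 2 w)), isLyndonFactor_leftMorph ?_ ?_,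
      ?_, ?_⟩
    · exact ShiftedFactor.of_cons_eq_leftMorph h2F hy
    · rw [h2e] at h2L hl hy
      exact (isLyndon_of_cons_eq_leftMorph (by decide) hl hy).2 h2L
    · rw [lastClass_leftMorph, lastClass, getLast?_of_cons_eq (by simp) hy,
        rightMorph_getLast? (by simp)]
      rfl
    · exact lengthVec_of_cons_eq_rightMorph hy
  · have hl : (0 :: w).getLast? ≠ some 2 := by
      intro hl
      rw [lastClass, if_pos hl] at hc0
      exact absurd hc0 (by decide)
    have hz : 2 :: 0 :: leftMorph 2 w = leftMorph 2 (0 :: w) := by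
      rw [leftMorph_cons_ne (by decide)]
    refine ⟨leftMorph 0 (rightMorph 1 (0 :: leftMorph 2 w)), isLyndonFactor_leftMorph ?_ ?_,
      ?_, ?_⟩
    · have : ShiftedFactor 2 (0 :: leftMorph 2 w) := ShiftedFactor.of_cons_eq_leftMorph hF hz
      exact this.image_right
    · exact (isLyndon_rightMorph (by decide)).2
        ((isLyndon_of_cons_eq_leftMorph (by decide) hl hz).2 hL)
    · rw [lastClass_leftMorph, lastClass_rightMorph_one]
    · exact lengthVec_rightMorph_of_cons_eq hz

theorem LyndonVec.exists_isLyndonFactor {c : Fin 3} {v : ℤ × ℤ × ℤ} (h : LyndonVec c v) :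
    c = 2 ∧ v = 0 ∨ ∃ x, IsLyndonFactor x ∧ lastClass x = c ∧ lengthVec x = v := by
  induction h with
  | source => exact Or.inl ⟨rfl, rfl⟩
  | @step c c' v d _ hd ih =>
    rcases ih with ⟨rfl, rfl⟩ | ⟨w, hw, rfl, rfl⟩
    · rw [show shiftThree 0 = 0 from rfl, zero_add]
      have hedges : ∀ e ∈ lyndonEdges, e.1 = 2 → e.2.1 = 2 ∧ e.2.2 = 0 ∨
          ∃ x ∈ ([[0], [0, 1], [0, 2], [0, 1, 0, 2], [0, 1, 0, 1, 0, 2]] : List (List (Fin 3))),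
            lastClass x = e.2.1 ∧ lengthVec x = e.2.2 := by
        decide
      rcases hedges _ hd rfl with h | ⟨x, hx, hc, hv⟩
      · exact Or.inl h
      · refine Or.inr ⟨x, ?_, hc, hv⟩
        simp only [List.mem_cons, List.not_mem_nil, or_false] at hx
        rcases hx with rfl | rfl | rfl | rfl | rfl <;>
          exact isLyndonFactor_of_shiftedPrefix (by decide) (by decide) rfl
    · exact Or.inr (hw.exists_step hd)

/-- The lengths of the Lyndon factors of the Tribonacci word. -/
theorem exists_isLyndon_length_iff {n : ℕ} :
    (∃ x : List (Fin 3), x.length = n ∧ IsFactorOf x tribWord ∧ IsLyndon x) ↔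
      ∃ c v, LyndonVec c v ∧ c ≠ 2 ∧ v.1 = n := by
  constructor
  · rintro ⟨x, rfl, hF, hL⟩
    rw [isFactorOf_tribWord_iff] at hF
    obtain ⟨a, t, rfl⟩ := List.exists_cons_of_ne_nil hL.1
    by_cases ha : a = 0
    · subst ha
      refine ⟨_, _, IsLyndonFactor.lyndonVec ⟨hF, hL, rfl⟩, ?_, lengthVec_fst _⟩
      rw [lastClass]
      split_ifs <;> decide
    -- The first letter is minimal, so the word avoids 0 and is a single letter; the word 0 has the
    -- same length.
    · have h0 : 0 ∉ a :: t := fun h0 => ha (Fin.le_zero_iff.1 (hL.le_of_mem h0))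
      have := hF.length_le_one_of_zero_notMem h0
      refine ⟨0, (1, 2, 4), LyndonVec.of_source (by decide), by decide, ?_⟩
      simp at this
      simp [this]
  · rintro ⟨c, v, h, hc, hv⟩
    rcases h.exists_isLyndonFactor with ⟨h, -⟩ | ⟨x, hx, -, rfl⟩
    · exact absurd h hc
    · rw [lengthVec_fst] at hv
      exact ⟨x, by exact_mod_cast hv, isFactorOf_tribWord_iff.2 hx.factor, hx.lyndon⟩

/-! ### Tribonacci representations, three digits at a time. -/

/-- The values of `w`, `w0` and `w00`. -/
def repVec (w : List (Fin 2)) : ℤ × ℤ × ℤ :=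
  (tribValue w, tribValue (w ++ [0]), tribValue (w ++ [0, 0]))

theorem tribValue_append (u v : List (Fin 2)) :
    tribValue (u ++ v) = tribValue (u ++ List.replicate v.length 0) + tribValue v := by
  induction u with
  | nil =>
    have : ∀ k, tribValue (List.replicate k 0) = 0 := by
      intro k
      induction k with
      | zero => rfl
      | succ k ih => simp [List.replicate_succ, tribValue, ih]
    simp [this]
  | cons a u ih => simp [tribValue, ih, add_assoc]

theorem tribValue_append_zeros (w : List (Fin 2)) : tribValue (w ++ [0, 0, 0]) =
    tribValue (w ++ [0, 0]) + tribValue (w ++ [0]) + tribValue w := by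
  induction w with
  | nil => rfl
  | cons a w ih =>
    have h : trib (w.length + 3 + 2) =
        trib (w.length + 2 + 2) + trib (w.length + 1 + 2) + trib (w.length + 2) :=
      trib.eq_4 (w.length + 2)
    simp only [List.cons_append, tribValue, List.length_append, List.length_cons,
      List.length_nil, ih]
    simp only [Nat.zero_add, Nat.reduceAdd, h]
    ring

/-- By the recurrence, three appended zeros act as `shiftThree`; the digits of `t` then add their
own value. -/
theorem repVec_append (w : List (Fin 2)) {t : List (Fin 2)} (ht : t.length = 3) :
    repVec (w ++ t) = shiftThree (repVec w) + repVec t := by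
  have h0 := tribValue_append_zeros w
  have h1 := tribValue_append_zeros (w ++ [0])
  have h2 := tribValue_append_zeros (w ++ [0, 0])
  have e0 := tribValue_append w t
  have e1 := tribValue_append w (t ++ [0])
  have e2 := tribValue_append w (t ++ [0, 0])
  simp only [ht, List.length_append, List.length_cons, List.length_nil, List.append_assoc,
    List.cons_append, List.nil_append, List.replicate, Nat.zero_add, Nat.reduceAdd]
    at h0 h1 h2 e0 e1 e2
  simp only [repVec, shiftThree, Prod.mk_add_mk, List.append_assoc, Prod.mk.injEq]
  refine ⟨?_, ?_, ?_⟩ <;> push_cast [e0, e1, e2, h0, h1, h2] <;> ring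

/-- The words of length `3`. -/
def digitTriples : List (List (Fin 2)) :=
  [[0, 0, 0], [0, 0, 1], [0, 1, 0], [0, 1, 1], [1, 0, 0], [1, 0, 1], [1, 1, 0], [1, 1, 1]]

theorem mem_digitTriples {t : List (Fin 2)} (ht : t.length = 3) : t ∈ digitTriples := by
  obtain ⟨a, b, c, rfl⟩ := List.length_eq_three.1 ht
  revert a b c
  decide

/-! ### Simulations between the automaton and the graph. -/

/-- Rows `(q, X)` such that every word `w` of length divisible by `3` that starts with `000` and
leads to a live state of `lyndonDFA` leads to the state `q` of some row with
`LyndonVec c (repVec w + v)` for all `(c, v)` in `X`. -/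
def dfaCarries : List (Fin 67 × List (Fin 3 × ℤ × ℤ × ℤ)) :=
  [(0, [(0, 1, 2, 4), (2, 0, 0, 0)]), (1, [(0, 0, 0, 0), (0, 1, 2, 3), (1, 1, 1, 2)]),
    (2, [(0, 0, 0, 0), (0, 1, 2, 4), (1, 0, -1, -1)]), (3, [(0, 0, 0, 0), (1, 1, 1, 2)]),
    (4, [(1, 0, 0, 0), (1, 1, 2, 4)]), (5, [(1, 0, 0, 0), (1, 1, 2, 3)]),
    (6, [(0, 1, 2, 4), (1, 0, 0, 0)]), (7, [(0, 0, 0, 0)]), (8, [(0, 1, 2, 3), (1, 1, 1, 2)]),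
    (9, [(0, 0, 0, 0), (0, 2, 3, 6), (1, 0, -1, -1)]), (10, [(0, 1, 1, 2), (1, 1, 1, 2)]),
    (11, [(0, 0, 0, 0), (1, 0, 0, 0)]), (12, [(0, 1, 2, 3)]), (13, [(0, 1, 2, 4)]),
    (14, [(0, 0, 0, 0)]), (15, [(1, 1, 2, 4)]), (16, [(1, 0, 0, 0)]), (17, [(0, 1, 2, 4)]),
    (18, [(1, 1, 1, 2)]), (19, [(0, 2, 3, 6), (1, 0, -1, -1)]), (10, [(0, 1, 1, 2)]),
    (20, [(1, 1, 2, 4)]), (21, [(1, 0, 0, 0)]), (22, [(0, 1, 2, 4)]), (23, [(0, 0, 0, 0)]),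
    (24, []), (25, []), (26, [(1, 1, 1, 2)]), (27, [(1, 0, 0, 0)]), (28, [(0, 1, 2, 4)]),
    (29, [(0, 0, 0, 0)]), (30, [(1, 1, 2, 4)]), (31, [(1, 0, 0, 0)]),
    (32, [(0, 0, 0, 0), (0, 2, 3, 6), (1, 0, -1, -1)]), (33, [(0, 1, 1, 2), (1, 1, 1, 2)]),
    (34, [(0, 0, 0, 0), (1, 0, 0, 0)]), (35, [(0, 1, 2, 3)]), (36, []), (37, []), (38, []),
    (39, []), (40, []), (41, []), (42, [(1, 0, 0, 0)]), (43, [(0, 1, 2, 4)]), (44, []), (45, []),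
    (46, []), (47, [(1, 1, 2, 4)]), (48, [(1, 0, 0, 0)]), (49, [(0, 1, 2, 4)]),
    (48, [(0, 0, 0, 0)]), (50, [(0, 2, 3, 6), (1, 0, -1, -1)]), (33, [(0, 1, 1, 2)]), (51, []),
    (52, [(1, 0, 0, 0)]), (53, [(0, 1, 2, 4)]), (54, []), (55, [(1, 1, 1, 2)]),
    (56, [(1, 0, 0, 0)]), (57, []), (58, []), (59, []), (60, [(1, 1, 1, 2)]),
    (61, [(0, 2, 3, 6), (1, 0, -1, -1)]), (62, [(0, 1, 1, 2)]), (63, []), (64, []), (65, [])]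

/-- Rows `(c, X)` such that every vector `l` with `LyndonVec c l` has a row for which each
`(v, q)` in `X` comes from a word `w` that leads to `q` in `lyndonDFA`, with `l = repVec w + v`. -/
def vecCarries : List (Fin 3 × List ((ℤ × ℤ × ℤ) × Fin 67)) :=
  [(2, [((0, 0, 0), 0)]), (0, [((0, 0, 0), 1), ((1, 2, 4), 0)]),
    (0, [((0, 0, 0), 2), ((1, 2, 3), 1)]), (1, [((0, -1, -1), 2), ((1, 1, 2), 1)]),
    (1, [((0, 0, 0), 4), ((1, 1, 2), 3)]), (1, [((0, 0, 0), 6), ((1, 2, 3), 5)]),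
    (0, [((0, 0, 0), 7), ((1, 2, 4), 6)]), (1, [((0, 0, 0), 5), ((1, 2, 4), 4)]),
    (0, [((0, 0, 0), 3), ((1, 2, 4), 2)]), (0, [((0, 0, 0), 7), ((1, 2, 3), 12)]),
    (1, [((0, 0, 0), 11), ((1, 1, 2), 10)]), (0, [((0, 0, 0), 9), ((1, 2, 3), 8)]),
    (0, [((0, 0, 0), 11), ((1, 1, 2), 10), ((2, 3, 6), 9)]),
    (1, [((0, -1, -1), 9), ((1, 1, 2), 8)]),
    (0, [((0, 0, 0), 7), ((1, 1, 2), 10), ((2, 3, 6), 19)]),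
    (1, [((0, -1, -1), 19), ((1, 1, 2), 18)]), (1, [((0, 0, 0), 27), ((1, 1, 2), 26)]),
    (0, [((0, 0, 0), 7), ((1, 2, 4), 17)]), (1, [((0, 0, 0), 31), ((1, 2, 4), 30)]),
    (0, [((0, 0, 0), 29), ((1, 2, 4), 28)]), (0, [((0, 0, 0), 23), ((1, 2, 4), 22)]),
    (1, [((0, 0, 0), 21), ((1, 2, 4), 20)]), (1, [((0, 0, 0), 16), ((1, 2, 4), 15)]),
    (0, [((0, 0, 0), 14), ((1, 2, 4), 13)]), (0, [((0, 0, 0), 29), ((1, 2, 3), 35)]),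
    (1, [((0, 0, 0), 34), ((1, 1, 2), 33)]), (0, [((0, 0, 0), 32), ((1, 2, 3), 8)]),
    (0, [((0, 0, 0), 34), ((1, 1, 2), 33), ((2, 3, 6), 32)]),
    (1, [((0, -1, -1), 32), ((1, 1, 2), 8)]),
    (0, [((0, 0, 0), 23), ((1, 1, 2), 33), ((2, 3, 6), 50)]),
    (1, [((0, -1, -1), 50), ((1, 1, 2), 18)]), (0, [((0, 0, 0), 23), ((1, 2, 4), 53)]),
    (1, [((0, 0, 0), 52), ((1, 2, 4), 30)]), (0, [((0, 0, 0), 29), ((1, 2, 4), 43)]),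
    (1, [((0, 0, 0), 42), ((1, 2, 4), 47)]), (0, [((0, 0, 0), 48), ((1, 2, 4), 49)]),
    (1, [((0, 0, 0), 48), ((1, 2, 4), 47)]), (1, [((0, 0, 0), 42), ((1, 2, 4), 15)]),
    (1, [((0, 0, 0), 56), ((1, 1, 2), 55)]),
    (0, [((0, 0, 0), 48), ((1, 1, 2), 62), ((2, 3, 6), 61)]),
    (1, [((0, -1, -1), 61), ((1, 1, 2), 60)])]

/-- Every new carry has a predecessor among the old ones along an edge, so `LyndonVec` is
transported. An empty list of carries claims nothing. -/
theorem dfaCarries_step : ∀ e ∈ dfaCarries, ∀ t ∈ digitTriples,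
    lyndonDFA.evalFrom e.1 t = 66 ∨ ∃ e' ∈ dfaCarries, e'.1 = lyndonDFA.evalFrom e.1 t ∧
      ∀ p' ∈ e'.2, ∃ p ∈ e.2, ∃ g ∈ lyndonEdges, g.1 = p.1 ∧ g.2.1 = p'.1 ∧
        repVec t + p'.2 = shiftThree p.2 + g.2.2 := by
  decide +kernel

theorem dfaCarries_accept : ∀ e ∈ dfaCarries, (lyndonTable e.1).2.2 = true →
    ∃ p ∈ e.2, p.1 ≠ 2 ∧ p.2.1 = 0 := by
  decide +kernel

/-- A row keeps several alternative words for one vector, since the one that can be continued may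
depend on the next edge. -/
theorem vecCarries_step : ∀ e ∈ vecCarries, ∀ g ∈ lyndonEdges, g.1 = e.1 →
    ∃ e' ∈ vecCarries, e'.1 = g.2.1 ∧ ∀ p' ∈ e'.2, ∃ p ∈ e.2, ∃ t ∈ digitTriples,
      lyndonDFA.evalFrom p.2 t = p'.2 ∧ repVec t + p'.1 = shiftThree p.1 + g.2.2 := by
  decide +kernel

theorem vecCarries_accept : ∀ e ∈ vecCarries, e.1 ≠ 2 →
    ∃ p ∈ e.2, p.1.1 = 0 ∧ (lyndonTable p.2).2.2 = true := by
  decide +kernel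

theorem lyndonDFA_evalFrom_dead (w : List (Fin 2)) : lyndonDFA.evalFrom 66 w = 66 := by
  induction w with
  | nil => rfl
  | cons a w ih =>
    have : ∀ a, lyndonDFA.step 66 a = 66 := by decide
    rw [DFA.evalFrom_cons, this, ih]

theorem lyndonDFA_evalFrom_of_infix {w : List (Fin 2)} (h : [1, 1, 1] <:+: w) (q : Fin 67) :
    lyndonDFA.evalFrom q w = 66 := by
  obtain ⟨u, v, rfl⟩ := h
  have : ∀ q, lyndonDFA.evalFrom q [1, 1, 1] = 66 := by decide +kernel
  rw [DFA.evalFrom_of_append, DFA.evalFrom_of_append, this, lyndonDFA_evalFrom_dead]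

theorem lyndonDFA_eval_cons_zero (w : List (Fin 2)) :
    lyndonDFA.eval (0 :: w) = lyndonDFA.eval w := rfl

theorem lyndonDFA_eval_zeros (k : ℕ) (w : List (Fin 2)) :
    lyndonDFA.eval (List.replicate k 0 ++ w) = lyndonDFA.eval w := by
  induction k with
  | zero => rfl
  | succ k ih => rw [List.replicate_succ, List.cons_append, lyndonDFA_eval_cons_zero, ih]

theorem tribValue_zeros (k : ℕ) (w : List (Fin 2)) :
    tribValue (List.replicate k 0 ++ w) = tribValue w := by
  induction k with
  | zero => rfl
  | succ k ih => simp [List.replicate_succ, tribValue, ih]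

/-- Leading zeros loop at the initial state and 111 leads to the dead state, so an accepted word is
canonical up to leading zeros. -/
theorem exists_canonicalRep_of_accepts : ∀ {w : List (Fin 2)}, w ∈ lyndonDFA.accepts →
    ∃ r, IsCanonicalRep (tribValue w) r ∧ r ∈ lyndonDFA.accepts
  | [], h => ⟨[], ⟨rfl, by simp, by simp⟩, h⟩
  | 0 :: w, h => by
    obtain ⟨r, hr, h⟩ := exists_canonicalRep_of_accepts (w := w) h
    exact ⟨r, by simpa [tribValue] using hr, h⟩
  | 1 :: w, h => by
    refine ⟨1 :: w, ⟨rfl, by simp, fun hw => ?_⟩, h⟩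
    rw [DFA.mem_accepts, DFA.eval, lyndonDFA_evalFrom_of_infix hw] at h
    exact absurd h (by change ¬ (lyndonTable 66).2.2 = true; decide)

theorem tribRep_mem_accepts_iff {n : ℕ} : tribRep n ∈ lyndonDFA.accepts ↔
    ∃ w ∈ lyndonDFA.accepts, tribValue w = n := by
  constructor
  · exact fun h => ⟨_, h, (tribRep_spec n).1⟩
  · rintro ⟨w, hw, rfl⟩
    obtain ⟨r, hr, h⟩ := exists_canonicalRep_of_accepts hw
    rwa [(existsUnique_canonicalRep _).unique (tribRep_spec _) hr]

theorem exists_dfaCarries_of_eval (k : ℕ) : ∀ w : List (Fin 2), w.length = 3 * k →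
    lyndonDFA.eval ([0, 0, 0] ++ w) = 66 ∨ ∃ e ∈ dfaCarries,
      e.1 = lyndonDFA.eval ([0, 0, 0] ++ w) ∧
        ∀ p ∈ e.2, LyndonVec p.1 (repVec ([0, 0, 0] ++ w) + p.2) := by
  induction k with
  | zero =>
    intro w hw
    obtain rfl := List.eq_nil_of_length_eq_zero hw
    refine Or.inr ⟨(0, [(0, 1, 2, 4), (2, 0, 0, 0)]), by decide, rfl, ?_⟩
    rw [show repVec ([0, 0, 0] ++ []) = 0 from rfl]
    simp only [zero_add, List.mem_cons, List.not_mem_nil, or_false]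
    rintro p (rfl | rfl)
    · exact LyndonVec.of_source (by decide)
    · exact LyndonVec.source
  | succ k ih =>
    intro w hw
    obtain ⟨u, t, rfl, hu, ht⟩ : ∃ u t, w = u ++ t ∧ u.length = 3 * k ∧ t.length = 3 :=
      ⟨w.take (3 * k), w.drop (3 * k), by simp, by simp; omega, by simp; omega⟩
    rw [← List.append_assoc, DFA.eval, DFA.evalFrom_of_append, repVec_append _ ht]
    rcases ih u hu with h | ⟨e, he, heq, h⟩
    · rw [DFA.eval] at h
      rw [h]
      exact Or.inl (lyndonDFA_evalFrom_dead t)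
    · rw [DFA.eval] at heq
      rw [← heq]
      refine (dfaCarries_step e he t (mem_digitTriples ht)).imp_right ?_
      rintro ⟨e', he', heq', h'⟩
      refine ⟨e', he', heq', fun p' hp' => ?_⟩
      obtain ⟨⟨c, v⟩, hp, ⟨c₁, c₂, d⟩, hg, h1, h2, h3⟩ := h' p' hp'
      simp only at h1 h2 h3
      subst h1 h2
      have := (h _ hp).step hg
      rwa [shiftThree_add, add_assoc, ← h3, ← add_assoc] at this

theorem LyndonVec.exists_vecCarries {c : Fin 3} {l : ℤ × ℤ × ℤ} (h : LyndonVec c l) :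
    ∃ e ∈ vecCarries, e.1 = c ∧
      ∀ p ∈ e.2, ∃ w, lyndonDFA.eval w = p.2 ∧ repVec w + p.1 = l := by
  induction h with
  | source =>
    refine ⟨(2, [((0, 0, 0), 0)]), by decide, rfl, ?_⟩
    simp only [List.mem_cons, List.not_mem_nil, or_false]
    rintro p rfl
    exact ⟨[], rfl, rfl⟩
  | @step c c' l d _ hd ih =>
    obtain ⟨e, he, rfl, h⟩ := ih
    obtain ⟨e', he', heq, h'⟩ := vecCarries_step e he _ hd rfl
    refine ⟨e', he', heq, fun p' hp' => ?_⟩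
    obtain ⟨p, hp, t, ht, h1, h2⟩ := h' p' hp'
    obtain ⟨w, hw, hwl⟩ := h p hp
    have ht3 : t.length = 3 := by
      have : ∀ t ∈ digitTriples, t.length = 3 := by decide
      exact this t ht
    refine ⟨w ++ t, ?_, ?_⟩
    · rw [DFA.eval, DFA.evalFrom_of_append, ← DFA.eval, hw, h1]
    · rw [repVec_append w ht3, add_assoc, h2, ← add_assoc, ← shiftThree_add, hwl]

theorem theorem15 (n : ℕ) :
    (∃ x : List (Fin 3), x.length = n ∧ IsFactorOf x tribWord ∧ IsLyndon x) ↔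
      tribRep n ∈ lyndonDFA.accepts := by
  rw [exists_isLyndon_length_iff]
  constructor
  · rintro ⟨c, l, h, hc, hl⟩
    obtain ⟨e, he, rfl, hX⟩ := h.exists_vecCarries
    obtain ⟨p, hp, hp0, hacc⟩ := vecCarries_accept e he hc
    obtain ⟨w, hw, rfl⟩ := hX p hp
    rw [Prod.fst_add, hp0, add_zero] at hl
    refine tribRep_mem_accepts_iff.2 ⟨w, ?_, Nat.cast_injective (R := ℤ) hl⟩
    rw [DFA.mem_accepts, hw]
    exact hacc
  · intro h
    have hacc : (lyndonTable (lyndonDFA.eval (tribRep n))).2.2 = true := h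
    -- Padding with zeros to a multiple of three digits changes neither value nor final state.
    obtain ⟨k, j, hk⟩ : ∃ k j, j + (tribRep n).length = 3 * k :=
      ⟨(tribRep n).length, 2 * (tribRep n).length, by omega⟩
    have heval := lyndonDFA_eval_zeros (3 + j) (tribRep n)
    have hval := tribValue_zeros (3 + j) (tribRep n)
    rw [List.replicate_add, List.append_assoc] at heval hval
    rw [← heval] at hacc
    rcases exists_dfaCarries_of_eval k (List.replicate j 0 ++ tribRep n) (by simpa using hk) with
      h | ⟨e, he, heq, h⟩
    · rw [show List.replicate 3 (0 : Fin 2) = [0, 0, 0] from rfl, h] at hacc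
      exact absurd hacc (by decide)
    · obtain ⟨p, hp, hp2, hp0⟩ := dfaCarries_accept e he (heq ▸ hacc)
      refine ⟨p.1, _, h p hp, hp2, ?_⟩
      rw [(tribRep_spec n).1] at hval
      rw [Prod.fst_add, hp0, add_zero]
      exact congrArg Nat.cast hval
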